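/- For a convex body (non-empty compact convex set) $K\subset\mathbb R^n$, the Steiner formula $\mathrm{vol}(K+tB_2^n)=\sum_{i=0}^n\binom ni \mathrm W_i(K)\,t^i$, $t\ge 0$, where $B_2^n$ is the closed Euclidean unit ball, defines the quermassintegrals $\mathrm W_i(K)$. With $\kappa_i=\mathrm{vol}_i(B_2^i)$, the intrinsic volumes of $K$ are $\mathrm V_i(K)=\binom ni \mathrm W_{n-i}(K)/\kappa_{n-i}$, $i=0,\dots,n$, and its Wills functional is $\mathcal W(K)=\sum_{i=0}^n \mathrm V_i(K)$. **Theorem.** Let $K,L\subset\mathbb R^2$ be convex bodies and let $\lambda\in(0,1)$. Then $$\mathcal W\bigl((1-\lambda)K+\lambda L\bigr)^{1/3}\ \ge\ (1-\lambda)\,\mathcal W(K)^{1/3}+\lambda\,\mathcal W(L)^{1/3}.$$ -/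

import Mathlib

open MeasureTheory
open scoped Pointwise

/-- The closed Euclidean unit ball of `ℝⁿ`. -/
def unitBall (n : ℕ) : Set (EuclideanSpace ℝ (Fin n)) := Metric.closedBall 0 1

/-- `κ n`, the `n`-dimensional volume of the Euclidean unit ball of `ℝⁿ` (with `κ 0 = 1`). -/
noncomputable def kappa (n : ℕ) : ℝ := volume.real (unitBall n)

/-- `W` is the sequence `W₀, …, Wₙ` of normalized coefficients in the Steiner formula
`vol (K + t B) = ∑ i, (n choose i) Wᵢ tⁱ` for all `t ≥ 0`, where `B` is the unit ball. -/
def IsSteinerSequence {n : ℕ} (K : ConvexBody (EuclideanSpace ℝ (Fin n)))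
    (W : Fin (n + 1) → ℝ) : Prop :=
  ∀ t : ℝ, 0 ≤ t →
    volume.real ((K : Set (EuclideanSpace ℝ (Fin n))) + t • unitBall n)
      = ∑ i : Fin (n + 1), (n.choose i : ℝ) * W i * t ^ (i : ℕ)

/-- The coefficients in the Steiner formula are unique. -/
theorem IsSteinerSequence.unique {n : ℕ} {K : ConvexBody (EuclideanSpace ℝ (Fin n))}
    {W W' : Fin (n + 1) → ℝ} (h : IsSteinerSequence K W) (h' : IsSteinerSequence K W') :
    W = W' := by
  have key : (∑ i : Fin (n + 1), Polynomial.monomial (i : ℕ) ((n.choose i : ℝ) * W i))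
      = ∑ i : Fin (n + 1), Polynomial.monomial (i : ℕ) ((n.choose i : ℝ) * W' i) := by
    apply Polynomial.eq_of_infinite_eval_eq
    refine (Set.Ici_infinite (0 : ℝ)).mono fun t ht => ?_
    have e := (h t ht).symm.trans (h' t ht)
    simpa [Polynomial.eval_finsetSum] using e
  funext j
  have hj := congrArg (fun p => Polynomial.coeff p (j : ℕ)) key
  have hc : (n.choose j : ℝ) ≠ 0 := by
    exact_mod_cast (Nat.choose_pos (Nat.lt_succ_iff.mp j.isLt)).ne'
  simp only [Polynomial.finsetSum_coeff, Polynomial.coeff_monomial, Fin.val_inj,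
    Finset.sum_ite_eq', Finset.mem_univ, if_true] at hj
  exact mul_left_cancel₀ hc hj

open Classical in
/-- The quermassintegrals `Wᵢ(K)`, `0 ≤ i ≤ n`, of a convex body `K` in `ℝⁿ`: the normalized
coefficients in its Steiner formula. (They exist for every convex body by Steiner's theorem; the
value `0` is only there to make the definition total.) -/
noncomputable def quermassintegral {n : ℕ} (K : ConvexBody (EuclideanSpace ℝ (Fin n)))
    (i : Fin (n + 1)) : ℝ :=
  if h : ∃ W : Fin (n + 1) → ℝ, IsSteinerSequence K W then h.choose i else 0

theorem IsSteinerSequence.quermassintegral_eq {n : ℕ}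
    {K : ConvexBody (EuclideanSpace ℝ (Fin n))} {W : Fin (n + 1) → ℝ}
    (h : IsSteinerSequence K W) (i : Fin (n + 1)) : quermassintegral K i = W i := by
  have hex : ∃ W : Fin (n + 1) → ℝ, IsSteinerSequence K W := ⟨W, h⟩
  rw [quermassintegral, dif_pos hex]
  exact congrFun (hex.choose_spec.unique h) i

/-- The intrinsic volumes `Vᵢ(K) = (n choose i) W_{n-i}(K) / κ_{n-i}`, `0 ≤ i ≤ n`. -/
noncomputable def intrinsicVolume {n : ℕ} (K : ConvexBody (EuclideanSpace ℝ (Fin n)))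
    (i : Fin (n + 1)) : ℝ :=
  (n.choose i : ℝ) / kappa (n - i) * quermassintegral K (Fin.rev i)

/-- The Wills functional, the sum of all the intrinsic volumes. -/
noncomputable def wills {n : ℕ} (K : ConvexBody (EuclideanSpace ℝ (Fin n))) : ℝ :=
  ∑ i : Fin (n + 1), intrinsicVolume K i

/-! In the plane the Steiner polynomial is vol K + βt + πt², so V₂ = vol K, V₁ = β/2, V₀ = 1, and
evaluating at t = 1/2 gives W(K) = vol(K + B/2) + (1 - π/4) (`wills_eq_volume`). By Brunn–Minkowski,
√vol(K + B/2) is concave under Minkowski combination.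

It remains to compose with x ↦ (x² + c)^(1/3), c = 1 - π/4. This function is increasing for x ≥ 0,
and concave exactly where x² ≥ 3c. Since K + B/2 contains a disc of radius 1/2, x² ≥ π/4, and π/4 ≥
3(1 - π/4) says precisely that π ≥ 3.

Both classical inputs are proved here. Brunn–Minkowski (`brunn_minkowski_prod`) comes from comparing
superlevel sets of slice lengths, each normalized by its supremum. The Steiner formula
(`isSteinerSummand_closedBall`) is elementary for zonotopes, since adding a segment adds its length
times a width, and it passes to the disc as a limit of zonotopes. -/

/-! ### Brunn–Minkowski on the line and, by slicing, in the plane -/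

theorem volume_combo_le {X Y Z : Set ℝ} {p q : ℝ} (hp : 0 < p) (hq : 0 < q)
    (hX : X.Nonempty) (hY : Y.Nonempty) (bX : Bornology.IsBounded X) (bY : Bornology.IsBounded Y)
    (hZ : Z.OrdConnected) (h : ∀ x ∈ X, ∀ y ∈ Y, p * x + q * y ∈ Z) :
    ENNReal.ofReal p * volume X + ENNReal.ofReal q * volume Y ≤ volume Z := by
  have vol_le : ∀ W : Set ℝ, Bornology.IsBounded W →
      volume W ≤ ENNReal.ofReal (sSup W - sInf W) := by
    intro W bW
    rw [← Real.volume_Icc]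
    exact measure_mono (subset_Icc_csInf_csSup bW.bddBelow bW.bddAbove)
  have le_sup : ∀ W : Set ℝ, W.Nonempty → Bornology.IsBounded W → 0 ≤ sSup W - sInf W :=
    fun W hW bW => sub_nonneg.2 (csInf_le_csSup hW bW.bddBelow bW.bddAbove)
  have hsub : Set.Ioo (p * sInf X + q * sInf Y) (p * sSup X + q * sSup Y) ⊆ Z := by
    intro w hw
    -- The gap between `w` and each endpoint is shared equally by the two summands, so that one
    -- combination falls below `w` and another above; order-connectedness then catches `w`.
    obtain ⟨x₁, hx₁, h₁⟩ := exists_lt_of_csInf_lt hX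
      (show sInf X < sInf X + (w - (p * sInf X + q * sInf Y)) / (2 * p) from
        lt_add_of_pos_right _ (div_pos (sub_pos.2 hw.1) (by positivity)))
    obtain ⟨y₁, hy₁, h₂⟩ := exists_lt_of_csInf_lt hY
      (show sInf Y < sInf Y + (w - (p * sInf X + q * sInf Y)) / (2 * q) from
        lt_add_of_pos_right _ (div_pos (sub_pos.2 hw.1) (by positivity)))
    obtain ⟨x₂, hx₂, h₃⟩ := exists_lt_of_lt_csSup hX
      (show sSup X - (p * sSup X + q * sSup Y - w) / (2 * p) < sSup X from
        sub_lt_self _ (div_pos (sub_pos.2 hw.2) (by positivity)))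
    obtain ⟨y₂, hy₂, h₄⟩ := exists_lt_of_lt_csSup hY
      (show sSup Y - (p * sSup X + q * sSup Y - w) / (2 * q) < sSup Y from
        sub_lt_self _ (div_pos (sub_pos.2 hw.2) (by positivity)))
    refine hZ.out (h x₁ hx₁ y₁ hy₁) (h x₂ hx₂ y₂ hy₂) ⟨?_, ?_⟩
    · have e₁ := mul_lt_mul_of_pos_left h₁ hp
      have e₂ := mul_lt_mul_of_pos_left h₂ hq
      have e₃ : p * ((w - (p * sInf X + q * sInf Y)) / (2 * p))
        + q * ((w - (p * sInf X + q * sInf Y)) / (2 * q)) = w - (p * sInf X + q * sInf Y) := by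
        field_simp; ring
      linarith
    · have e₁ := mul_lt_mul_of_pos_left h₃ hp
      have e₂ := mul_lt_mul_of_pos_left h₄ hq
      have e₃ : p * ((p * sSup X + q * sSup Y - w) / (2 * p))
        + q * ((p * sSup X + q * sSup Y - w) / (2 * q)) = p * sSup X + q * sSup Y - w := by
        field_simp; ring
      linarith
  calc ENNReal.ofReal p * volume X + ENNReal.ofReal q * volume Y
      ≤ ENNReal.ofReal p * ENNReal.ofReal (sSup X - sInf X)
        + ENNReal.ofReal q * ENNReal.ofReal (sSup Y - sInf Y) := by
        gcongr
        · exact vol_le X bX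
        · exact vol_le Y bY
    _ = volume (Set.Ioo (p * sInf X + q * sInf Y) (p * sSup X + q * sSup Y)) := by
        rw [Real.volume_Ioo, ← ENNReal.ofReal_mul hp.le, ← ENNReal.ofReal_mul hq.le,
          ← ENNReal.ofReal_add (mul_nonneg hp.le (le_sup X hX bX))
            (mul_nonneg hq.le (le_sup Y hY bY))]
        congr 1; ring
    _ ≤ volume Z := measure_mono hsub

/-- The length of the vertical slice of a planar set. -/
noncomputable def sliceLength (K : Set (ℝ × ℝ)) (x : ℝ) : ℝ := volume.real (Prod.mk x ⁻¹' K)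

theorem isCompact_slice {K : Set (ℝ × ℝ)} (hK : IsCompact K) (x : ℝ) :
    IsCompact (Prod.mk x ⁻¹' K) := by
  have : Prod.mk x ⁻¹' K ⊆ Prod.snd '' K := fun y hy => ⟨(x, y), hy, rfl⟩
  exact (hK.image continuous_snd).of_isClosed_subset
    (hK.isClosed.preimage (by fun_prop)) this

theorem convex_slice {K : Set (ℝ × ℝ)} (hK : Convex ℝ K) (x : ℝ) :
    Convex ℝ (Prod.mk x ⁻¹' K) := by
  intro y hy z hz a b ha hb hab
  have := hK hy hz ha hb hab
  have e : a • (x, y) + b • (x, z) = (x, a • y + b • z) := by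
    ext
    · simp [← add_mul, hab]
    · simp
  rwa [e] at this

theorem ofReal_sliceLength {K : Set (ℝ × ℝ)} (hK : IsCompact K) (x : ℝ) :
    ENNReal.ofReal (sliceLength K x) = volume (Prod.mk x ⁻¹' K) :=
  ENNReal.ofReal_toReal (isCompact_slice hK x).measure_lt_top.ne

theorem measurable_sliceLength {K : Set (ℝ × ℝ)} (hK : IsCompact K) :
    Measurable (sliceLength K) :=
  (measurable_measure_prodMk_left hK.measurableSet).ennreal_toReal

theorem sliceLength_nonneg (K : Set (ℝ × ℝ)) (x : ℝ) : 0 ≤ sliceLength K x := measureReal_nonneg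

theorem nonempty_slice_of_pos {K : Set (ℝ × ℝ)} {x : ℝ} (h : 0 < sliceLength K x) :
    (Prod.mk x ⁻¹' K).Nonempty := by
  by_contra hne
  rw [Set.not_nonempty_iff_eq_empty] at hne
  simp [sliceLength, hne] at h

theorem lintegral_sliceLength {K : Set (ℝ × ℝ)} (hK : IsCompact K) :
    ∫⁻ x, ENNReal.ofReal (sliceLength K x) = volume K := by
  rw [Measure.volume_eq_prod, Measure.prod_apply hK.measurableSet]
  exact lintegral_congr fun x => ofReal_sliceLength hK x

/-- The one-dimensional inequality applied to slices. Positivity makes both slices nonempty, without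
which the bound can fail. -/
theorem sliceLength_combo_le {K L M : Set (ℝ × ℝ)} (hK : IsCompact K) (hL : IsCompact L)
    (hM : IsCompact M) (cM : Convex ℝ M) {p q : ℝ} (hp : 0 < p) (hq : 0 < q)
    (h : ∀ k ∈ K, ∀ l ∈ L, p • k + q • l ∈ M) {x y : ℝ}
    (hx : 0 < sliceLength K x) (hy : 0 < sliceLength L y) :
    p * sliceLength K x + q * sliceLength L y ≤ sliceLength M (p * x + q * y) := by
  have key := volume_combo_le hp hq (nonempty_slice_of_pos hx) (nonempty_slice_of_pos hy)
    (isCompact_slice hK x).isBounded (isCompact_slice hL y).isBounded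
    (convex_slice cM (p * x + q * y)).ordConnected
    (fun u hu v hv => by simpa using h _ hu _ hv)
  rw [← ofReal_sliceLength hK, ← ofReal_sliceLength hL, ← ofReal_sliceLength hM,
    ← ENNReal.ofReal_mul hp.le, ← ENNReal.ofReal_mul hq.le,
    ← ENNReal.ofReal_add (by positivity) (by positivity)] at key
  exact (ENNReal.ofReal_le_ofReal_iff (sliceLength_nonneg _ _)).1 key

/-- Provides the order-connected target that `volume_combo_le` needs when applied to superlevel
sets. -/
theorem convex_sliceLength_superlevel {M : Set (ℝ × ℝ)} (hM : IsCompact M) (cM : Convex ℝ M)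
    {t : ℝ} (ht : 0 ≤ t) : Convex ℝ {x | t < sliceLength M x} := by
  rw [convex_iff_forall_pos]
  intro x hx y hy p q hp hq hpq
  simp only [Set.mem_ofPred_eq, smul_eq_mul] at *
  have := sliceLength_combo_le hM hM hM cM hp hq (fun k hk l hl => cM hk hl hp.le hq.le hpq)
    (ht.trans_lt hx) (ht.trans_lt hy)
  nlinarith

theorem volume_eq_lintegral_superlevel {K : Set (ℝ × ℝ)} (hK : IsCompact K) {m : ℝ}
    (hm : 0 < m) :
    volume K = ENNReal.ofReal m * ∫⁻ t in Set.Ioi 0, volume {x | m * t < sliceLength K x} := by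
  have h := lintegral_eq_lintegral_meas_lt (f := fun x => sliceLength K x / m) volume
    (Filter.Eventually.of_forall fun x => div_nonneg (sliceLength_nonneg K x) hm.le)
    ((measurable_sliceLength hK).div_const m).aemeasurable
  have e : ∀ t : ℝ, {x | t < sliceLength K x / m} = {x | m * t < sliceLength K x} := by
    intro t; ext x
    simp only [Set.mem_ofPred_eq, lt_div_iff₀ hm, mul_comm]
  simp only [e] at h
  rw [← h, ← lintegral_const_mul _ ((measurable_sliceLength hK).div_const m).ennreal_ofReal,
    ← lintegral_sliceLength hK]
  refine lintegral_congr fun x => ?_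
  rw [← ENNReal.ofReal_mul hm.le, mul_div_cancel₀ _ hm.ne']

/-- Layer-cake formula with heights measured relative to the supremum `a`: for two different bodies
the superlevel sets are then nonempty over the same range of `t`, and vanish beyond `t = 1`. -/
theorem exists_sup_sliceLength {K : Set (ℝ × ℝ)} (hK : IsCompact K) (h0 : 0 < volume K) :
    ∃ a : ℝ, 0 < a ∧ (∀ t < 1, {x | a * t < sliceLength K x}.Nonempty) ∧
      volume K
        = ENNReal.ofReal a * ∫⁻ t in Set.Ioo 0 1, volume {x | a * t < sliceLength K x} := by
  have bdd : BddAbove (Set.range (sliceLength K)) := by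
    refine ⟨volume.real (Prod.snd '' K), ?_⟩
    rintro _ ⟨x, rfl⟩
    exact measureReal_mono (fun y hy => ⟨(x, y), hy, rfl⟩)
      (hK.image continuous_snd).measure_lt_top.ne
  have hle : ∀ x, sliceLength K x ≤ ⨆ x, sliceLength K x := le_ciSup bdd
  have hpos : 0 < ⨆ x, sliceLength K x := by
    by_contra hn
    have : ∀ x, ENNReal.ofReal (sliceLength K x) = 0 := fun x =>
      ENNReal.ofReal_eq_zero.2 ((hle x).trans (not_lt.1 hn))
    rw [← lintegral_sliceLength hK] at h0
    simp [this] at h0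
  refine ⟨⨆ x, sliceLength K x, hpos, fun t ht => ?_, ?_⟩
  · exact exists_lt_of_lt_ciSup (mul_lt_of_lt_one_right hpos ht)
  · rw [volume_eq_lintegral_superlevel hK hpos]
    congr 1
    rw [← lintegral_indicator measurableSet_Ioi, ← lintegral_indicator measurableSet_Ioo]
    refine lintegral_congr fun t => ?_
    by_cases ht0 : 0 < t
    · by_cases ht1 : t < 1
      · simp [ht0, ht1]
      · have : {x | (⨆ x, sliceLength K x) * t < sliceLength K x} = ∅ := by
          ext x
          simp only [Set.mem_ofPred_eq, Set.mem_empty_iff_false, iff_false, not_lt]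
          exact (hle x).trans (le_mul_of_one_le_right hpos.le (not_lt.1 ht1))
        simp [Set.indicator, this]
    · simp [ht0]

/-- The Brunn–Minkowski inequality in the plane, for a convex upper set. -/
theorem brunn_minkowski_prod {K L M : Set (ℝ × ℝ)} (hK : IsCompact K)
    (hL : IsCompact L) (hM : IsCompact M) (cM : Convex ℝ M)
    (hK0 : 0 < volume.real K) (hL0 : 0 < volume.real L) {p q : ℝ} (hp : 0 < p) (hq : 0 < q)
    (h : ∀ k ∈ K, ∀ l ∈ L, p • k + q • l ∈ M) :
    (p * √(volume.real K) + q * √(volume.real L)) ^ 2 ≤ volume.real M := by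
  obtain ⟨a, ha, hna, hKa⟩ := exists_sup_sliceLength hK (ENNReal.toReal_pos_iff.1 hK0).1
  obtain ⟨b, hb, hnb, hLb⟩ := exists_sup_sliceLength hL (ENNReal.toReal_pos_iff.1 hL0).1
  have hm : 0 < p * a + q * b := by positivity
  set F := ∫⁻ t in Set.Ioo 0 1, volume {x | a * t < sliceLength K x} with hF
  set G := ∫⁻ t in Set.Ioo 0 1, volume {x | b * t < sliceLength L x} with hG
  have bound : ∀ {N : Set (ℝ × ℝ)}, IsCompact N → ∀ {t : ℝ}, 0 ≤ t →
      Bornology.IsBounded {x | t < sliceLength N x} := by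
    intro N hN t ht
    refine (hN.image continuous_fst).isBounded.subset fun x hx => ?_
    obtain ⟨y, hy⟩ := nonempty_slice_of_pos (ht.trans_lt hx)
    exact ⟨(x, y), hy, rfl⟩
  have hmeas : ∀ {N : Set (ℝ × ℝ)} {c : ℝ}, 0 < c →
      Measurable fun t => volume {x | c * t < sliceLength N x} := by
    intro N c hc
    refine Antitone.measurable fun s t hst => measure_mono fun x hx => ?_
    exact lt_of_le_of_lt (mul_le_mul_of_nonneg_left hst hc.le) hx
  -- The combination of the superlevel sets at heights `a * t` and `b * t` lies in that of `M` at
  -- height `(p * a + q * b) * t`; integrate over `t`.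
  have main : ENNReal.ofReal (p * a + q * b) * (ENNReal.ofReal p * F + ENNReal.ofReal q * G)
      ≤ volume M := by
    rw [volume_eq_lintegral_superlevel hM hm]
    gcongr
    rw [hF, hG, ← lintegral_const_mul _ (hmeas ha), ← lintegral_const_mul _ (hmeas hb),
      ← lintegral_add_left ((hmeas ha).const_mul _)]
    refine (setLIntegral_mono' measurableSet_Ioo fun t ht => ?_).trans
      (lintegral_mono_set Set.Ioo_subset_Ioi_self)
    refine volume_combo_le hp hq (hna t ht.2) (hnb t ht.2) (bound hK (mul_pos ha ht.1).le)
      (bound hL (mul_pos hb ht.1).le)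
      (convex_sliceLength_superlevel hM cM (mul_pos hm ht.1).le).ordConnected ?_
    intro x hx y hy
    simp only [Set.mem_ofPred_eq] at hx hy ⊢
    have := sliceLength_combo_le hK hL hM cM hp hq h
      ((mul_pos ha ht.1).trans hx) ((mul_pos hb ht.1).trans hy)
    nlinarith
  have hFtop : F ≠ ⊤ := by
    intro hF'
    rw [hF', ENNReal.mul_top (by simpa using ha)] at hKa
    exact hK.measure_lt_top.ne hKa
  have hGtop : G ≠ ⊤ := by
    intro hG'
    rw [hG', ENNReal.mul_top (by simpa using hb)] at hLb
    exact hL.measure_lt_top.ne hLb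
  have main' := ENNReal.toReal_mono hM.measure_lt_top.ne main
  rw [ENNReal.toReal_mul, ENNReal.toReal_add (ENNReal.mul_ne_top ENNReal.ofReal_ne_top hFtop)
    (ENNReal.mul_ne_top ENNReal.ofReal_ne_top hGtop), ENNReal.toReal_mul, ENNReal.toReal_mul,
    ENNReal.toReal_ofReal hm.le, ENNReal.toReal_ofReal hp.le, ENNReal.toReal_ofReal hq.le] at main'
  have eK : volume.real K = a * F.toReal := by
    rw [Measure.real, hKa, ENNReal.toReal_mul, ENNReal.toReal_ofReal ha.le]
  have eL : volume.real L = b * G.toReal := by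
    rw [Measure.real, hLb, ENNReal.toReal_mul, ENNReal.toReal_ofReal hb.le]
  refine le_trans ?_ main'
  have hF0 : 0 ≤ F.toReal := ENNReal.toReal_nonneg
  have hG0 : 0 ≤ G.toReal := ENNReal.toReal_nonneg
  rw [eK, eL, Real.sqrt_mul ha.le, Real.sqrt_mul hb.le]
  obtain ⟨s, hs⟩ : ∃ s, s = √a := ⟨_, rfl⟩
  obtain ⟨u, hu⟩ : ∃ u, u = √b := ⟨_, rfl⟩
  obtain ⟨v, hv⟩ : ∃ v, v = √F.toReal := ⟨_, rfl⟩
  obtain ⟨w, hw⟩ : ∃ w, w = √G.toReal := ⟨_, rfl⟩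
  have e1 : a = s ^ 2 := by rw [hs, Real.sq_sqrt ha.le]
  have e2 : b = u ^ 2 := by rw [hu, Real.sq_sqrt hb.le]
  have e3 : F.toReal = v ^ 2 := by rw [hv, Real.sq_sqrt hF0]
  have e4 : G.toReal = w ^ 2 := by rw [hw, Real.sq_sqrt hG0]
  rw [← hs, ← hu, ← hv, ← hw, e1, e2, e3, e4]
  -- Cauchy–Schwarz: the difference of the two sides is pq(sw - uv)².
  nlinarith [mul_nonneg (mul_nonneg hp.le hq.le) (sq_nonneg (s * w - u * v))]

/-! ### Area and width under addition of a segment -/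

/-- Every nonempty horizontal slice is a compact interval and grows by exactly `2 * c`; empty ones
stay empty. Fubini concludes. -/
theorem volume_add_segment_prod {K : Set (ℝ × ℝ)} (hK : IsCompact K) (cK : Convex ℝ K)
    {c : ℝ} (hc : 0 ≤ c) :
    volume.real (K + Set.Icc (-c) c ×ˢ {0})
      = volume.real K + 2 * c * volume.real (Prod.snd '' K) := by
  have hslice : ∀ y, volume ((fun x => (x, y)) ⁻¹' (K + Set.Icc (-c) c ×ˢ {(0 : ℝ)}))
      = volume ((fun x => (x, y)) ⁻¹' K)
        + (Prod.snd '' K).indicator (fun _ => ENNReal.ofReal (2 * c)) y := by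
    intro y
    have e : (fun x => (x, y)) ⁻¹' (K + Set.Icc (-c) c ×ˢ {(0 : ℝ)})
        = ((fun x => (x, y)) ⁻¹' K) + Set.Icc (-c) c := by
      ext x
      simp only [Set.mem_preimage, Set.mem_add, Set.mem_prod, Set.mem_singleton_iff]
      constructor
      · rintro ⟨⟨k₁, k₂⟩, hk, ⟨s, z⟩, ⟨hs, hz⟩, hsum⟩
        simp only [Prod.mk_add_mk, Prod.mk.injEq] at hsum hz
        obtain ⟨h1, h2⟩ := hsum
        subst hz
        rw [add_zero] at h2
        subst h2
        exact ⟨k₁, hk, s, hs, h1⟩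
      · rintro ⟨k, hk, s, hs, rfl⟩
        exact ⟨(k, y), hk, (s, 0), ⟨hs, rfl⟩, by simp⟩
    rw [e]
    by_cases hy : y ∈ Prod.snd '' K
    · have hne : ((fun x => (x, y)) ⁻¹' K).Nonempty := by
        obtain ⟨⟨x, y'⟩, hk, rfl⟩ := hy
        exact ⟨x, hk⟩
      have hcomp : IsCompact ((fun x => (x, y)) ⁻¹' K) :=
        (hK.image continuous_fst).of_isClosed_subset
          (hK.isClosed.preimage (by fun_prop)) (fun x hx => ⟨(x, y), hx, rfl⟩)
      have hconv : Convex ℝ ((fun x => (x, y)) ⁻¹' K) := by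
        intro u hu v hv a b ha hb hab
        have := cK hu hv ha hb hab
        have e : a • (u, y) + b • (v, y) = (a • u + b • v, y) := by
          ext
          · simp
          · simp [← add_mul, hab]
        rwa [e] at this
      have hI := eq_Icc_of_connected_compact (hconv.isConnected hne) hcomp
      have hle := csInf_le_csSup hne hcomp.bddBelow hcomp.bddAbove
      rw [hI, Set.Icc_add_Icc hle (by linarith), Real.volume_Icc, Real.volume_Icc,
        Set.indicator_of_mem hy, ← ENNReal.ofReal_add (by linarith) (by linarith)]
      congr 1; ring
    · have : (fun x => (x, y)) ⁻¹' K = ∅ := by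
        rw [← Set.not_nonempty_iff_eq_empty]
        rintro ⟨x, hx⟩
        exact hy ⟨(x, y), hx, rfl⟩
      simp [this, hy]
  have hS : IsCompact (K + Set.Icc (-c) c ×ˢ {(0 : ℝ)}) :=
    hK.add (isCompact_Icc.prod isCompact_singleton)
  have hP := hK.image continuous_snd
  have key : volume (K + Set.Icc (-c) c ×ˢ {(0 : ℝ)})
      = volume K + ENNReal.ofReal (2 * c) * volume (Prod.snd '' K) := by
    rw [Measure.volume_eq_prod, Measure.prod_apply_symm hS.measurableSet,
      Measure.prod_apply_symm hK.measurableSet, lintegral_congr hslice,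
      lintegral_add_left (measurable_measure_prodMk_right hK.measurableSet),
      lintegral_indicator_const hP.measurableSet]
  rw [Measure.real, key, ENNReal.toReal_add hK.measure_lt_top.ne
    (ENNReal.mul_ne_top ENNReal.ofReal_ne_top hP.measure_lt_top.ne), ENNReal.toReal_mul,
    ENNReal.toReal_ofReal (by positivity)]
  rfl

theorem volume_add_of_convex_compact {A B : Set ℝ} (hA : IsCompact A) (cA : Convex ℝ A)
    (nA : A.Nonempty) (hB : IsCompact B) (cB : Convex ℝ B) (nB : B.Nonempty) :
    volume.real (A + B) = volume.real A + volume.real B := by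
  have eA := eq_Icc_of_connected_compact (cA.isConnected nA) hA
  have eB := eq_Icc_of_connected_compact (cB.isConnected nB) hB
  have lA := csInf_le_csSup nA hA.bddBelow hA.bddAbove
  have lB := csInf_le_csSup nB hB.bddBelow hB.bddAbove
  rw [eA, eB, Set.Icc_add_Icc lA lB, Real.volume_real_Icc_of_le lA, Real.volume_real_Icc_of_le lB,
    Real.volume_real_Icc_of_le (by linarith)]
  ring

/-- Real coordinates on `ℂ` in which the direction `exp (iθ)` is the first axis. -/
noncomputable def rotCoord (θ : ℝ) : ℂ ≃L[ℝ] ℝ × ℝ :=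
  (rotation (Circle.exp (-θ))).toContinuousLinearEquiv.trans Complex.equivRealProdCLM

theorem measurePreserving_rotCoord (θ : ℝ) : MeasurePreserving (rotCoord θ) volume volume :=
  Complex.volume_preserving_equiv_real_prod.comp
    (rotation (Circle.exp (-θ))).measurePreserving

theorem rotCoord_exp (θ : ℝ) : rotCoord θ (Circle.exp θ : ℂ) = (1, 0) := by
  have : rotation (Circle.exp (-θ)) (Circle.exp θ : ℂ) = 1 := by
    rw [rotation_apply, ← Circle.coe_mul, ← Circle.exp_add]
    simp
  change Complex.equivRealProdCLM (rotation (Circle.exp (-θ)) (Circle.exp θ : ℂ)) = (1, 0)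
  rw [this]
  rfl

/-- The centred segment of half-length `c` in direction `exp (iθ)`. -/
noncomputable def centredSegment (θ c : ℝ) : Set ℂ :=
  (fun s : ℝ => s • (Circle.exp θ : ℂ)) '' Set.Icc (-c) c

theorem isCompact_centredSegment (θ c : ℝ) : IsCompact (centredSegment θ c) :=
  isCompact_Icc.image (by fun_prop)

theorem convex_centredSegment (θ c : ℝ) : Convex ℝ (centredSegment θ c) :=
  (convex_Icc (-c) c).is_linear_image (IsLinearMap.isLinearMap_smul' _)

theorem nonempty_centredSegment (θ : ℝ) {c : ℝ} (hc : 0 ≤ c) : (centredSegment θ c).Nonempty :=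
  (Set.nonempty_Icc.2 (by linarith)).image _

theorem smul_centredSegment (θ c : ℝ) {t : ℝ} (ht : 0 ≤ t) (hc : 0 ≤ c) :
    t • centredSegment θ c = centredSegment θ (t * c) := by
  have hI : t • Set.Icc (-c) c = Set.Icc (-(t * c)) (t * c) := by
    rcases ht.eq_or_lt with rfl | ht
    · rw [Set.zero_smul_set (Set.nonempty_Icc.2 (by linarith))]
      simp only [zero_mul, neg_zero, Set.Icc_self]
      rfl
    · rw [LinearOrderedField.smul_Icc ht]
      simp
  rw [centredSegment, centredSegment, ← hI]
  ext z
  simp only [Set.mem_smul_set, Set.mem_image]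
  constructor
  · rintro ⟨_, ⟨s, hs, rfl⟩, rfl⟩
    exact ⟨t • s, ⟨s, hs, rfl⟩, by rw [smul_assoc]⟩
  · rintro ⟨_, ⟨s, hs, rfl⟩, rfl⟩
    exact ⟨_, ⟨s, hs, rfl⟩, by rw [smul_assoc]⟩

/-- The width of a set orthogonally to the direction `exp (iθ)`. -/
noncomputable def width (θ : ℝ) (K : Set ℂ) : ℝ :=
  volume.real ((fun z => (rotCoord θ z).2) '' K)

theorem width_add (θ : ℝ) {A B : Set ℂ} (hA : IsCompact A) (cA : Convex ℝ A) (nA : A.Nonempty)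
    (hB : IsCompact B) (cB : Convex ℝ B) (nB : B.Nonempty) :
    width θ (A + B) = width θ A + width θ B := by
  let f : ℂ →L[ℝ] ℝ := (ContinuousLinearMap.snd ℝ ℝ ℝ).comp (rotCoord θ : ℂ →L[ℝ] ℝ × ℝ)
  have e : ∀ K, width θ K = volume.real (f '' K) := fun K => rfl
  rw [e, e, e, Set.image_add]
  exact volume_add_of_convex_compact (hA.image f.continuous) (cA.linear_image f.toLinearMap)
    (nA.image f) (hB.image f.continuous) (cB.linear_image f.toLinearMap) (nB.image f)

theorem width_smul (θ : ℝ) (A : Set ℂ) {t : ℝ} (ht : 0 ≤ t) :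
    width θ (t • A) = t * width θ A := by
  have e : (fun z => (rotCoord θ z).2) '' (t • A) = t • ((fun z => (rotCoord θ z).2) '' A) := by
    ext z
    simp only [Set.mem_image, Set.mem_smul_set]
    constructor
    · rintro ⟨_, ⟨y, hy, rfl⟩, rfl⟩
      exact ⟨_, ⟨y, hy, rfl⟩, by rw [map_smul]; rfl⟩
    · rintro ⟨_, ⟨y, hy, rfl⟩, rfl⟩
      exact ⟨_, ⟨y, hy, rfl⟩, by rw [map_smul]; rfl⟩
  rw [width, e, Measure.real, Measure.addHaar_smul, ENNReal.toReal_mul,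
    ENNReal.toReal_ofReal (abs_nonneg _)]
  simp [abs_of_nonneg ht, width, Measure.real]

theorem volume_image_rotCoord (θ : ℝ) {K : Set ℂ} (hK : IsCompact K) :
    volume.real (rotCoord θ '' K) = volume.real K := by
  have h := (measurePreserving_rotCoord θ).measureReal_preimage
    (hK.image (rotCoord θ).continuous).measurableSet.nullMeasurableSet
  rw [← h, Set.preimage_image_eq _ (rotCoord θ).injective]

theorem volume_add_centredSegment (θ : ℝ) {K : Set ℂ} (hK : IsCompact K) (cK : Convex ℝ K)
    {c : ℝ} (hc : 0 ≤ c) :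
    volume.real (K + centredSegment θ c) = volume.real K + 2 * c * width θ K := by
  have e : rotCoord θ '' centredSegment θ c = Set.Icc (-c) c ×ˢ {0} := by
    rw [centredSegment, Set.image_image]
    ext ⟨x, y⟩
    simp only [map_smul, rotCoord_exp, Set.mem_image, Set.mem_prod, Set.mem_singleton_iff,
      Prod.smul_mk, smul_eq_mul, mul_one, mul_zero, Prod.mk.injEq]
    constructor
    · rintro ⟨s, hs, rfl, rfl⟩
      exact ⟨hs, rfl⟩
    · rintro ⟨hs, rfl⟩
      exact ⟨x, hs, rfl, rfl⟩
  rw [← volume_image_rotCoord θ (hK.add (isCompact_centredSegment θ c)), Set.image_add, e,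
    volume_add_segment_prod (hK.image (rotCoord θ).continuous)
      (cK.linear_image (rotCoord θ).toLinearMap) hc, volume_image_rotCoord θ hK, width,
    Set.image_image]

/-! ### Steiner formula for zonotopes -/

/-- `Z` is a summand for which the planar Steiner formula is a quadratic polynomial. -/
def IsSteinerSummand (Z : Set ℂ) : Prop :=
  ∀ K : Set ℂ, IsCompact K → Convex ℝ K → K.Nonempty → ∃ β : ℝ, ∀ t : ℝ, 0 ≤ t →
    volume.real (K + t • Z) = volume.real K + β * t + volume.real Z * t ^ 2

theorem isSteinerSummand_zero : IsSteinerSummand 0 := by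
  intro K _ _ _
  refine ⟨0, fun t _ => ?_⟩
  have h0 : volume.real (0 : Set ℂ) = 0 := by simp [Measure.real, ← Set.singleton_zero]
  rw [smul_zero, add_zero, h0]
  ring

/-- The segment contributes 2ct · width(K + tZ), and width is additive and homogeneous. The t² part,
2c · width(Z), is just what turns vol Z into the area of the new summand. -/
theorem IsSteinerSummand.add_centredSegment {Z : Set ℂ} (h : IsSteinerSummand Z)
    (hZ : IsCompact Z) (cZ : Convex ℝ Z) (nZ : Z.Nonempty) (θ : ℝ) {c : ℝ} (hc : 0 ≤ c) :
    IsSteinerSummand (Z + centredSegment θ c) := by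
  intro K hK cK nK
  obtain ⟨β, hβ⟩ := h K hK cK nK
  refine ⟨β + 2 * c * width θ K, fun t ht => ?_⟩
  rw [smul_add, ← add_assoc, smul_centredSegment θ c ht hc,
    volume_add_centredSegment θ (hK.add (hZ.smul t)) (cK.add (cZ.smul t)) (by positivity),
    width_add θ hK cK nK (hZ.smul t) (cZ.smul t) nZ.smul_set, width_smul θ Z ht, hβ t ht,
    volume_add_centredSegment θ hZ cZ hc]
  ring

theorem zonotope_properties {c : ℝ} (hc : 0 ≤ c) (θ : ℕ → ℝ) (s : Finset ℕ) :
    IsSteinerSummand (∑ k ∈ s, centredSegment (θ k) c) ∧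
      IsCompact (∑ k ∈ s, centredSegment (θ k) c) ∧
      Convex ℝ (∑ k ∈ s, centredSegment (θ k) c) ∧
      (∑ k ∈ s, centredSegment (θ k) c).Nonempty := by
  classical
  induction s using Finset.induction_on with
  | empty =>
    simp only [Finset.sum_empty]
    exact ⟨isSteinerSummand_zero, isCompact_singleton, convex_singleton 0, Set.singleton_nonempty 0⟩
  | insert a s ha ih =>
    obtain ⟨h1, h2, h3, h4⟩ := ih
    rw [Finset.sum_insert ha, add_comm]
    exact ⟨h1.add_centredSegment h2 h3 h4 _ hc, h2.add (isCompact_centredSegment _ _),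
      h3.add (convex_centredSegment _ _), h4.add (nonempty_centredSegment _ hc)⟩

/-! ### Zonotopes approximating the disc -/

/-- The sum in `h` is the support function of the zonotope. A point of the disc outside it would be
strictly separated by some `v`, against `h v`. -/
theorem closedBall_subset_zonotope {c A : ℝ} (hc : 0 ≤ c) (θ : ℕ → ℝ) (s : Finset ℕ)
    (h : ∀ v : ℂ, A * ‖v‖ ≤ ∑ k ∈ s, c * |inner ℝ v (Circle.exp (θ k) : ℂ)|) :
    Metric.closedBall 0 A ⊆ ∑ k ∈ s, centredSegment (θ k) c := by
  intro b hb
  by_contra hn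
  obtain ⟨-, h2, h3, -⟩ := zonotope_properties hc θ s
  obtain ⟨f, u, hf, hu⟩ := geometric_hahn_banach_closed_point h3 h2.isClosed hn
  set v := (InnerProductSpace.toDual ℝ ℂ).symm f
  have hfv : ∀ x, f x = inner ℝ v x := fun x => (InnerProductSpace.toDual_symm_apply).symm
  -- The point maximizing the inner product with `v`: in each segment take the endpoint given by the
  -- sign.
  have hz : ∑ k ∈ s, (c * SignType.sign (inner ℝ v (Circle.exp (θ k) : ℂ)) : ℝ) •
      (Circle.exp (θ k) : ℂ) ∈ ∑ k ∈ s, centredSegment (θ k) c := by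
    rw [Set.mem_finsetSum]
    refine ⟨_, fun {k} _ => ⟨_, ?_, rfl⟩, rfl⟩
    generalize inner ℝ v (Circle.exp (θ k) : ℂ) = y
    rcases lt_trichotomy y 0 with h | h | h
    · simp [sign_neg h, hc]
    · simp [h, hc]
    · simp [sign_pos h, hc]
  have h5 := (hf _ hz).trans hu
  rw [hfv, hfv, inner_sum] at h5
  have h6 : ∑ k ∈ s, inner ℝ v ((c * SignType.sign (inner ℝ v (Circle.exp (θ k) : ℂ)) : ℝ) •
      (Circle.exp (θ k) : ℂ)) = ∑ k ∈ s, c * |inner ℝ v (Circle.exp (θ k) : ℂ)| := by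
    refine Finset.sum_congr rfl fun k _ => ?_
    rw [inner_smul_right, mul_assoc, sign_mul_self]
  rw [h6] at h5
  have h7 := real_inner_le_norm v b
  have h8 : ‖b‖ ≤ A := by simpa using hb
  nlinarith [h v, norm_nonneg v, mul_le_mul_of_nonneg_left h8 (norm_nonneg v)]

theorem zonotope_subset_closedBall {c A : ℝ} (θ : ℕ → ℝ) (s : Finset ℕ)
    (h : ∀ v : ℂ, ∑ k ∈ s, c * |inner ℝ v (Circle.exp (θ k) : ℂ)| ≤ A * ‖v‖) :
    ∑ k ∈ s, centredSegment (θ k) c ⊆ Metric.closedBall 0 A := by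
  intro z hz
  rw [Set.mem_finsetSum] at hz
  obtain ⟨g, hg, hz⟩ := hz
  have h1 : inner ℝ z z ≤ ∑ k ∈ s, c * |inner ℝ z (Circle.exp (θ k) : ℂ)| := by
    nth_rewrite 2 [← hz]
    rw [inner_sum]
    refine Finset.sum_le_sum fun k hk => ?_
    obtain ⟨r, hr, hrg⟩ := hg hk
    rw [← hrg]
    simp only [inner_smul_right]
    refine (le_abs_self _).trans ?_
    rw [abs_mul]
    exact mul_le_mul_of_nonneg_right (abs_le.2 hr) (abs_nonneg _)
  have h2 := h1.trans (h z)
  rw [real_inner_self_eq_norm_sq] at h2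
  rw [mem_closedBall_zero_iff]
  by_contra hn
  have hn := not_le.1 hn
  rcases (norm_nonneg z).eq_or_lt with h0 | h0
  · have hz0 : z = 0 := norm_eq_zero.1 h0.symm
    -- At `z = 0` only `0 ≤ A` is needed. The segments being nonempty forces `0 ≤ c`, and `h 1` then
    -- bounds `A` below.
    have h3 := h 1
    have h4 : 0 ≤ ∑ k ∈ s, c * |inner ℝ (1 : ℂ) (Circle.exp (θ k) : ℂ)| := by
      refine Finset.sum_nonneg fun k hk => mul_nonneg ?_ (abs_nonneg _)
      obtain ⟨r, hr, -⟩ := hg hk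
      have := hr.1.trans hr.2
      linarith
    simp at h3
    simp at h4
    linarith
  · nlinarith

theorem integral_abs_cos_sub (α : ℝ) : ∫ x in (0 : ℝ)..Real.pi, |Real.cos (α - x)| = 2 := by
  have hp : Function.Periodic (fun x => |Real.cos x|) Real.pi := fun x => by
    simp [Real.cos_add_pi]
  rw [intervalIntegral.integral_comp_sub_left (fun x => |Real.cos x|)]
  have := hp.intervalIntegral_add_eq (α - Real.pi) (-(Real.pi / 2))
  rw [sub_add_cancel] at this
  rw [sub_zero, this]
  have e : -(Real.pi / 2) + Real.pi = Real.pi / 2 := by ring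
  rw [e]
  have : ∫ x in (-(Real.pi / 2))..(Real.pi / 2), |Real.cos x|
      = ∫ x in (-(Real.pi / 2))..(Real.pi / 2), Real.cos x := by
    refine intervalIntegral.integral_congr fun x hx => ?_
    rw [Set.uIcc_of_le (by linarith [Real.pi_pos])] at hx
    exact abs_of_nonneg (Real.cos_nonneg_of_mem_Icc hx)
  rw [this, integral_cos]
  simp
  norm_num

/-- As |cos| is 1-Lipschitz, each of the `N` cells of length π/N errs by at most (π/N)². Uniformity
in `α` gives uniform control of the zonotope's support function. -/
theorem abs_riemann_sum_abs_cos_sub_le (α : ℝ) {N : ℕ} (hN : 0 < N) :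
    |(∑ k ∈ Finset.range N, Real.pi / N * |Real.cos (α - k * (Real.pi / N))|) - 2|
      ≤ Real.pi ^ 2 / N := by
  have hN' : (0 : ℝ) < N := by exact_mod_cast hN
  set h := Real.pi / N with hh
  have h0 : 0 < h := div_pos Real.pi_pos hN'
  have hint : ∀ a b : ℝ, IntervalIntegrable (fun x => |Real.cos (α - x)|) volume a b :=
    fun a b => Continuous.intervalIntegrable (by fun_prop) a b
  have hsum := intervalIntegral.sum_integral_adjacent_intervals (μ := volume)
    (f := fun x => |Real.cos (α - x)|) (a := fun k : ℕ => k * h) (n := N) fun k _ => hint _ _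
  have hNh : N * h = Real.pi := by rw [hh]; field_simp
  simp only [Nat.cast_zero, zero_mul, hNh, integral_abs_cos_sub] at hsum
  rw [← hsum, ← Finset.sum_sub_distrib]
  refine (Finset.abs_sum_le_sum_abs _ _).trans ?_
  have hterm : ∀ k ∈ Finset.range N, |h * |Real.cos (α - k * h)|
      - (∫ x in (k * h : ℝ)..((k + 1 : ℕ) * h : ℝ), |Real.cos (α - x)|)| ≤ h * h := by
    intro k _
    have hlen : ((k + 1 : ℕ) * h : ℝ) - k * h = h := by push_cast; ring
    have hc : h * |Real.cos (α - k * h)|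
        = ∫ _ in (k * h : ℝ)..((k + 1 : ℕ) * h : ℝ), |Real.cos (α - k * h)| := by
      rw [intervalIntegral.integral_const, hlen, smul_eq_mul]
    rw [hc, ← intervalIntegral.integral_sub intervalIntegrable_const (hint _ _)]
    have := intervalIntegral.norm_integral_le_of_norm_le_const (C := h)
      (a := (k * h : ℝ)) (b := ((k + 1 : ℕ) * h : ℝ))
      (f := fun x => |Real.cos (α - k * h)| - |Real.cos (α - x)|) ?_
    · rwa [hlen, abs_of_pos h0] at this
    · intro x hx
      rw [Set.uIoc_of_le (by linarith)] at hx
      rw [Real.norm_eq_abs]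
      refine (abs_abs_sub_abs_le _ _).trans ((Real.abs_cos_sub_cos_le _ _).trans ?_)
      rw [abs_le]
      constructor <;> linarith [hx.1, hx.2]
  refine (Finset.sum_le_sum hterm).trans (le_of_eq ?_)
  rw [Finset.sum_const, Finset.card_range, nsmul_eq_mul, ← mul_assoc, hNh, hh]
  ring

theorem inner_exp (v : ℂ) (θ : ℝ) :
    inner ℝ v (Circle.exp θ : ℂ) = ‖v‖ * Real.cos (Complex.arg v - θ) := by
  rw [Complex.inner, Real.cos_sub, mul_add, ← mul_assoc, ← mul_assoc, Complex.norm_mul_cos_arg,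
    Complex.norm_mul_sin_arg, Circle.coe_exp, Complex.exp_mul_I]
  simp [← Complex.ofReal_cos, ← Complex.ofReal_sin]
  ring

theorem exists_steinerSummand_near_closedBall {ε : ℝ} (hε : 0 < ε) :
    ∃ Z : Set ℂ, IsSteinerSummand Z ∧ Metric.closedBall 0 1 ⊆ Z ∧
      Z ⊆ Metric.closedBall 0 (1 + ε) := by
  obtain ⟨N, hN⟩ := exists_nat_gt (Real.pi ^ 2 / min 1 (ε / 2))
  have hm : 0 < min 1 (ε / 2) := lt_min one_pos (by positivity)
  have hN' : (0 : ℝ) < N := lt_of_le_of_lt (by positivity) hN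
  have hN0 : 0 < N := by exact_mod_cast hN'
  set δ := Real.pi ^ 2 / N with hδ
  have hδm : δ < min 1 (ε / 2) := by
    rw [hδ, div_lt_iff₀ hN', mul_comm]
    exact (div_lt_iff₀ hm).1 hN
  have hδ1 := hδm.trans_le (min_le_left _ _)
  have hδ2 := hδm.trans_le (min_le_right _ _)
  have hδ0 : 0 < δ := by positivity
  -- Scaling by `r` makes the lower bound of the support function exactly 1; the upper one is r(2 +
  -- δ) = 1 + 2δr ≤ 1 + ε, by `r ≤ 1` and `δ < ε / 2`.
  set r := 1 / (2 - δ) with hr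
  have hr0 : 0 < r := one_div_pos.2 (by linarith)
  have hr1 : r * (2 - δ) = 1 := by rw [hr]; field_simp [show 2 - δ ≠ 0 by linarith]
  have hc : 0 ≤ r * (Real.pi / N) := by positivity
  have supp : ∀ v : ℂ, ∑ k ∈ Finset.range N,
      r * (Real.pi / N) * |inner ℝ v (Circle.exp (k * (Real.pi / N)) : ℂ)|
      = r * ‖v‖ * ∑ k ∈ Finset.range N,
        Real.pi / N * |Real.cos (Complex.arg v - k * (Real.pi / N))| := by
    intro v
    rw [Finset.mul_sum]
    refine Finset.sum_congr rfl fun k _ => ?_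
    rw [inner_exp, abs_mul, abs_norm]
    ring
  have est := fun v : ℂ => abs_le.1 (abs_riemann_sum_abs_cos_sub_le (Complex.arg v) hN0)
  refine ⟨∑ k ∈ Finset.range N, centredSegment (k * (Real.pi / N)) (r * (Real.pi / N)),
    (zonotope_properties hc (fun k => k * (Real.pi / N)) _).1,
    closedBall_subset_zonotope hc (fun k => k * (Real.pi / N)) _ fun v => ?_,
    zonotope_subset_closedBall (fun k => k * (Real.pi / N)) _ fun v => ?_⟩
  · rw [supp v]
    have h1 : 2 - δ ≤ ∑ k ∈ Finset.range N,
        Real.pi / N * |Real.cos (Complex.arg v - k * (Real.pi / N))| := by linarith [(est v).1]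
    calc 1 * ‖v‖ = r * ‖v‖ * (2 - δ) := by rw [← hr1]; ring
      _ ≤ _ := mul_le_mul_of_nonneg_left h1 (by positivity)
  · rw [supp v]
    have h1 : ∑ k ∈ Finset.range N,
        Real.pi / N * |Real.cos (Complex.arg v - k * (Real.pi / N))| ≤ 2 + δ := by
      linarith [(est v).2]
    have h2 : r * (2 + δ) ≤ 1 + ε := by
      have : r ≤ 1 := by rw [hr, div_le_one (by linarith)]; linarith
      nlinarith
    calc _ ≤ r * ‖v‖ * (2 + δ) := mul_le_mul_of_nonneg_left h1 (by positivity)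
      _ = r * (2 + δ) * ‖v‖ := by ring
      _ ≤ _ := mul_le_mul_of_nonneg_right h2 (norm_nonneg v)

/-! ### Passage to the disc -/

/-- The sets lie between K + tB and its closed t/(m+1)-thickening, whose area tends to that of the
compact set K + tB. -/
theorem tendsto_volume_add_smul {Z : ℕ → Set ℂ} (hZ : ∀ m, Metric.closedBall 0 1 ⊆ Z m)
    (hZ' : ∀ m : ℕ, Z m ⊆ Metric.closedBall 0 (1 + 1 / ((m : ℝ) + 1))) {K : Set ℂ}
    (hK : IsCompact K) {t : ℝ} (ht : 0 ≤ t) :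
    Filter.Tendsto (fun m => volume.real (K + t • Z m)) Filter.atTop
      (nhds (volume.real (K + t • Metric.closedBall (0 : ℂ) 1))) := by
  have hC : IsCompact (K + t • Metric.closedBall (0 : ℂ) 1) :=
    hK.add ((isCompact_closedBall _ _).smul t)
  have hsup : ∀ m : ℕ, K + t • Z m
      ⊆ Metric.cthickening (t * (1 / ((m : ℝ) + 1))) (K + t • Metric.closedBall (0 : ℂ) 1) := by
    intro m
    rw [← hC.add_closedBall_zero (by positivity), add_assoc, smul_closedBall _ _ zero_le_one,
      closedBall_add_closedBall (by positivity) (by positivity)]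
    refine Set.add_subset_add_left ((Set.smul_set_mono (hZ' m)).trans ?_)
    rw [smul_closedBall _ _ (by positivity)]
    refine Metric.closedBall_subset_closedBall' ?_
    simp [abs_of_nonneg ht, mul_add]
  have hlim : Filter.Tendsto (fun m : ℕ => volume.real (Metric.cthickening
      (t * (1 / ((m : ℝ) + 1))) (K + t • Metric.closedBall (0 : ℂ) 1))) Filter.atTop
      (nhds (volume.real (K + t • Metric.closedBall (0 : ℂ) 1))) := by
    have h0 : Filter.Tendsto (fun m : ℕ => t * (1 / ((m : ℝ) + 1))) Filter.atTop (nhds 0) := by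
      simpa using (tendsto_one_div_add_atTop_nhds_zero_nat (𝕜 := ℝ)).const_mul t
    exact (ENNReal.tendsto_toReal hC.measure_lt_top.ne).comp
      ((tendsto_measure_cthickening_of_isCompact hC).comp h0)
  have htop : ∀ m : ℕ, volume (Metric.cthickening (t * (1 / ((m : ℝ) + 1)))
      (K + t • Metric.closedBall (0 : ℂ) 1)) ≠ ⊤ :=
    fun m => (hC.isBounded.cthickening.isCompact_closure.measure_lt_top.trans_le'
      (measure_mono subset_closure)).ne
  refine tendsto_of_tendsto_of_tendsto_of_le_of_le tendsto_const_nhds hlim (fun m => ?_)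
    (fun m => ?_)
  · exact measureReal_mono (Set.add_subset_add_left (Set.smul_set_mono (hZ m)))
      (ne_top_of_le_ne_top (htop m) (measure_mono (hsup m)))
  · exact measureReal_mono (hsup m) (htop m)

theorem volume_real_closedBall_complex : volume.real (Metric.closedBall (0 : ℂ) 1) = Real.pi := by
  simp [Measure.real, Complex.volume_closedBall]

/-- The Steiner formula in the complex plane. -/
theorem isSteinerSummand_closedBall : IsSteinerSummand (Metric.closedBall 0 1) := by
  choose Z hS hZ hZ' using fun m : ℕ =>
    exists_steinerSummand_near_closedBall (ε := 1 / ((m : ℝ) + 1)) (by positivity)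
  intro K hK cK nK
  choose β hβ using fun m => hS m K hK cK nK
  have lim0 : Filter.Tendsto (fun m => volume.real (Z m)) Filter.atTop
      (nhds (volume.real (Metric.closedBall (0 : ℂ) 1))) := by
    simpa using tendsto_volume_add_smul hZ hZ' (isCompact_singleton (x := (0 : ℂ))) zero_le_one
  have lim := fun {t : ℝ} (ht : 0 ≤ t) => tendsto_volume_add_smul hZ hZ' hK ht
  -- The linear coefficient is determined by the value at `t = 1`, so the coefficients `β m`
  -- converge too.
  refine ⟨volume.real (K + (1 : ℝ) • Metric.closedBall (0 : ℂ) 1) - volume.real K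
    - volume.real (Metric.closedBall (0 : ℂ) 1), fun t ht => ?_⟩
  refine tendsto_nhds_unique (lim ht) ?_
  have hlimβ := ((lim zero_le_one).sub_const (volume.real K)).sub lim0
  refine (((hlimβ.mul_const t).const_add (volume.real K)).add (lim0.mul_const (t ^ 2))).congr
    fun m => ?_
  rw [hβ m t ht, hβ m 1 zero_le_one]
  ring

/-! ### Transfer to the Euclidean plane; the Wills functional as an area -/

/-- The volume-preserving identification of the Euclidean plane with `ℂ`. -/
noncomputable def planeToComplex : EuclideanSpace ℝ (Fin 2) ≃ₗᵢ[ℝ] ℂ :=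
  Complex.orthonormalBasisOneI.repr.symm

theorem volume_image_planeToComplex {K : Set (EuclideanSpace ℝ (Fin 2))} (hK : IsCompact K) :
    volume.real (planeToComplex '' K) = volume.real K := by
  have h := planeToComplex.measurePreserving.measureReal_preimage
    (hK.image planeToComplex.continuous).measurableSet.nullMeasurableSet
  rw [← h, Set.preimage_image_eq _ planeToComplex.injective]

theorem isCompact_unitBall (n : ℕ) : IsCompact (unitBall n) := isCompact_closedBall _ _

theorem exists_steiner_plane (K : ConvexBody (EuclideanSpace ℝ (Fin 2))) :
    ∃ β : ℝ, ∀ t : ℝ, 0 ≤ t →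
      volume.real ((K : Set (EuclideanSpace ℝ (Fin 2))) + t • unitBall 2)
        = volume.real (K : Set (EuclideanSpace ℝ (Fin 2))) + β * t + Real.pi * t ^ 2 := by
  obtain ⟨β, hβ⟩ := isSteinerSummand_closedBall
    (planeToComplex '' (K : Set (EuclideanSpace ℝ (Fin 2))))
    (K.isCompact.image planeToComplex.continuous)
    (K.convex.linear_image planeToComplex.toLinearEquiv.toLinearMap) (K.nonempty.image _)
  refine ⟨β, fun t ht => ?_⟩
  have hβ := hβ t ht
  rw [volume_image_planeToComplex K.isCompact, volume_real_closedBall_complex] at hβ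
  rw [← hβ, ← volume_image_planeToComplex (K.isCompact.add ((isCompact_unitBall 2).smul t)),
    Set.image_add, image_smul_set, unitBall, planeToComplex.image_closedBall, map_zero]

theorem volume_real_unitBall_two : volume.real (unitBall 2) = Real.pi := by
  rw [← volume_image_planeToComplex (isCompact_unitBall 2), unitBall,
    planeToComplex.image_closedBall, map_zero, volume_real_closedBall_complex]

theorem kappa_zero : kappa 0 = 1 := by
  have : unitBall 0 = Set.univ := by
    ext x
    simp [unitBall, Subsingleton.elim x 0]
  have h := (EuclideanSpace.volume_preserving_symm_measurableEquiv_toLp (Fin 0)).measure_preimage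
    MeasurableSet.univ.nullMeasurableSet
  rw [Set.preimage_univ] at h
  rw [kappa, this, Measure.real, h, volume_pi, Measure.pi_univ]
  simp

theorem kappa_one : kappa 1 = 2 := by
  rw [kappa, unitBall, Measure.real, EuclideanSpace.volume_closedBall]
  have : Real.Gamma (1 / 2 + 1) = √Real.pi / 2 := by
    rw [Real.Gamma_add_one (by norm_num), Real.Gamma_one_half_eq]; ring
  have hpi : √Real.pi ≠ 0 := (Real.sqrt_pos.2 Real.pi_pos).ne'
  simp only [Fintype.card_fin, Nat.cast_one, this, pow_one, ENNReal.ofReal_one, one_mul]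
  rw [ENNReal.toReal_ofReal (by positivity)]
  field_simp

theorem kappa_two : kappa 2 = Real.pi := volume_real_unitBall_two

theorem wills_eq_volume (K : ConvexBody (EuclideanSpace ℝ (Fin 2))) :
    wills K = volume.real ((K : Set (EuclideanSpace ℝ (Fin 2))) + (1 / 2 : ℝ) • unitBall 2)
      + (1 - Real.pi / 4) := by
  obtain ⟨β, hβ⟩ := exists_steiner_plane K
  have hS : IsSteinerSequence K
      ![volume.real (K : Set (EuclideanSpace ℝ (Fin 2))), β / 2, Real.pi] := by
    intro t ht
    rw [hβ t ht]
    have h2 : (2 : ℝ) * (β / 2) = β := by ring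
    simp [Fin.sum_univ_three, h2]
  have r0 : Fin.rev (0 : Fin 3) = 2 := rfl
  have r1 : Fin.rev (1 : Fin 3) = 1 := rfl
  have r2 : Fin.rev (2 : Fin 3) = 0 := rfl
  rw [hβ _ (by norm_num), wills, Fin.sum_univ_three]
  simp only [intrinsicVolume, r0, r1, r2, hS.quermassintegral_eq]
  simp [kappa_zero, kappa_one, kappa_two, Real.pi_ne_zero]
  ring

theorem brunn_minkowski_plane {K L M : Set (EuclideanSpace ℝ (Fin 2))} (hK : IsCompact K)
    (hL : IsCompact L) (hM : IsCompact M) (cM : Convex ℝ M)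
    (hK0 : 0 < volume.real K) (hL0 : 0 < volume.real L) {p q : ℝ} (hp : 0 < p) (hq : 0 < q)
    (h : ∀ k ∈ K, ∀ l ∈ L, p • k + q • l ∈ M) :
    (p * √(volume.real K) + q * √(volume.real L)) ^ 2 ≤ volume.real M := by
  let T : EuclideanSpace ℝ (Fin 2) ≃L[ℝ] ℝ × ℝ :=
    planeToComplex.toContinuousLinearEquiv.trans (rotCoord 0)
  have hT : ∀ {N : Set (EuclideanSpace ℝ (Fin 2))}, IsCompact N →
      volume.real (T '' N) = volume.real N := by
    intro N hN
    have : T '' N = rotCoord 0 '' (planeToComplex '' N) := by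
      rw [Set.image_image]; rfl
    rw [this, volume_image_rotCoord 0 (hN.image planeToComplex.continuous),
      volume_image_planeToComplex hN]
  rw [← hT hK, ← hT hL, ← hT hM]
  rw [← hT hK] at hK0
  rw [← hT hL] at hL0
  refine brunn_minkowski_prod (hK.image T.continuous) (hL.image T.continuous)
    (hM.image T.continuous) (cM.linear_image T.toLinearMap) hK0 hL0 hp hq ?_
  rintro _ ⟨k, hk, rfl⟩ _ ⟨l, hl, rfl⟩
  exact ⟨_, h k hk l hl, by simp⟩

/-! ### Concavity of the outer function and conclusion -/

/-- Concavity on `[d, ∞)` as a tangent-line bound at `z`, proved by cubing. With D(1 + r)³ expanded,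
the terms of order 0 and 1 in `r` leave only (x - z)² ≤ D r² (3 + r). -/
theorem rpow_third_le_tangent {d x z : ℝ} (hd : 0 < d) (hx : d ≤ x) (hz : d ≤ z) :
    (x ^ 2 + d ^ 2 / 3) ^ (1 / 3 : ℝ)
      ≤ (z ^ 2 + d ^ 2 / 3) ^ (1 / 3 : ℝ)
        * (1 + 2 * z * (x - z) / (3 * (z ^ 2 + d ^ 2 / 3))) := by
  have hz0 : 0 < z := hd.trans_le hz
  obtain ⟨D, hD⟩ : ∃ D, D = z ^ 2 + d ^ 2 / 3 := ⟨_, rfl⟩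
  rw [← hD]
  have hD0 : 0 < D := by rw [hD]; positivity
  set r := 2 * z * (x - z) / (3 * D) with hr
  have hrD : r * (3 * D) = 2 * z * (x - z) := div_mul_cancel₀ _ (by positivity)
  have hr1 : 0 ≤ 1 + r := by
    have : 0 ≤ (1 + r) * (3 * D) := by
      rw [add_mul, hrD, hD]; nlinarith
    exact nonneg_of_mul_nonneg_left this (by positivity)
  have key : x ^ 2 + d ^ 2 / 3 ≤ D * (1 + r) ^ 3 := by
    -- The right side increases with `x`, so `x = d` is the worst case; what remains is a quartic in
    -- `z` vanishing at `z = d`, with nonnegative coefficients in `z - d`.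
    have poly : 27 * D ^ 2 ≤ 4 * z ^ 2 * (9 * D + 2 * z * (x - z)) := by
      have h1 : 8 * z ^ 3 * d ≤ 8 * z ^ 3 * x := by gcongr
      have h2 : 0 ≤ z ^ 4 + 8 * z ^ 3 * d - 6 * d ^ 2 * z ^ 2 - 3 * d ^ 4 := by
        obtain ⟨s, rfl⟩ : ∃ s, z = d + s := ⟨z - d, by ring⟩
        have hs : 0 ≤ s := by linarith
        have : (d + s) ^ 4 + 8 * (d + s) ^ 3 * d - 6 * d ^ 2 * (d + s) ^ 2 - 3 * d ^ 4
            = s ^ 4 + 12 * d * s ^ 3 + 24 * d ^ 2 * s ^ 2 + 16 * d ^ 3 * s := by ring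
        rw [this]; positivity
      rw [hD]
      nlinarith
    have h3 : 9 * D ≤ 4 * z ^ 2 * (3 + r) := by
      have : 9 * D * (3 * D) ≤ 4 * z ^ 2 * (3 + r) * (3 * D) := by
        have e : 4 * z ^ 2 * (3 + r) * (3 * D) = 4 * z ^ 2 * (9 * D + r * (3 * D)) := by ring
        rw [e, hrD]; linarith
      exact le_of_mul_le_mul_right this (by positivity)
    have h4 : (x - z) ^ 2 ≤ D * r ^ 2 * (3 + r) := by
      have e : D * r ^ 2 * (3 + r) * (9 * D) = 4 * z ^ 2 * (3 + r) * (x - z) ^ 2 := by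
        have : D * r ^ 2 * (3 + r) * (9 * D) = (r * (3 * D)) ^ 2 * (3 + r) := by ring
        rw [this, hrD]; ring
      have : (x - z) ^ 2 * (9 * D) ≤ D * r ^ 2 * (3 + r) * (9 * D) := by
        rw [e]; nlinarith [mul_le_mul_of_nonneg_right h3 (sq_nonneg (x - z))]
      exact le_of_mul_le_mul_right this (by positivity)
    have e : D * (1 + r) ^ 3 = D + r * (3 * D) + D * r ^ 2 * (3 + r) := by ring
    rw [e, hrD, hD] at *
    nlinarith
  calc (x ^ 2 + d ^ 2 / 3) ^ (1 / 3 : ℝ) ≤ (D * (1 + r) ^ 3) ^ (1 / 3 : ℝ) :=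
        Real.rpow_le_rpow (by positivity) key (by norm_num)
    _ = D ^ (1 / 3 : ℝ) * (1 + r) := by
        rw [Real.mul_rpow hD0.le (by positivity), ← Real.rpow_natCast (1 + r) 3,
          ← Real.rpow_mul hr1]
        norm_num

theorem rpow_third_combo_le {d x y l : ℝ} (hd : 0 < d) (hx : d ≤ x) (hy : d ≤ y)
    (hl : l ∈ Set.Ioo (0 : ℝ) 1) :
    (1 - l) * (x ^ 2 + d ^ 2 / 3) ^ (1 / 3 : ℝ) + l * (y ^ 2 + d ^ 2 / 3) ^ (1 / 3 : ℝ)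
      ≤ (((1 - l) * x + l * y) ^ 2 + d ^ 2 / 3) ^ (1 / 3 : ℝ) := by
  have h1 : 0 < 1 - l := sub_pos.2 hl.2
  have hz : d ≤ (1 - l) * x + l * y := by nlinarith [hl.1]
  have e1 := mul_le_mul_of_nonneg_left (rpow_third_le_tangent hd hx hz) h1.le
  have e2 := mul_le_mul_of_nonneg_left (rpow_third_le_tangent hd hy hz) hl.1.le
  refine (add_le_add e1 e2).trans (le_of_eq ?_)
  ring

theorem pi_div_four_le_volume (K : ConvexBody (EuclideanSpace ℝ (Fin 2))) :
    Real.pi / 4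
      ≤ volume.real ((K : Set (EuclideanSpace ℝ (Fin 2))) + (1 / 2 : ℝ) • unitBall 2) := by
  obtain ⟨x, hx⟩ := K.nonempty
  have hC := K.isCompact.add ((isCompact_unitBall 2).smul (1 / 2 : ℝ))
  have h1 : volume.real ({x} + (1 / 2 : ℝ) • unitBall 2) = Real.pi / 4 := by
    rw [Set.singleton_add, Set.image_add_left, Measure.real, measure_preimage_add,
      Measure.addHaar_smul, ENNReal.toReal_mul, ENNReal.toReal_ofReal (abs_nonneg _)]
    have := volume_real_unitBall_two
    rw [Measure.real] at this
    rw [this]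
    simp [abs_of_pos]
    ring
  rw [← h1]
  exact measureReal_mono (Set.add_subset_add_right (Set.singleton_subset_iff.2 hx))
    hC.measure_lt_top.ne

theorem theoremt (K L : ConvexBody (EuclideanSpace ℝ (Fin 2))) (l : ℝ)
    (hl : l ∈ Set.Ioo (0 : ℝ) 1) :
    (1 - l) * wills K ^ (1 / 3 : ℝ) + l * wills L ^ (1 / 3 : ℝ)
      ≤ wills ((1 - l) • K + l • L) ^ (1 / 3 : ℝ) := by
  have h1 : 0 < 1 - l := sub_pos.2 hl.2
  have hπ := Real.pi_gt_three
  have hπ4 := Real.pi_lt_four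
  have compact := fun K : ConvexBody (EuclideanSpace ℝ (Fin 2)) =>
    K.isCompact.add ((isCompact_unitBall 2).smul (1 / 2 : ℝ))
  have cB : Convex ℝ ((1 / 2 : ℝ) • unitBall 2) := (convex_closedBall _ _).smul _
  have hBM := brunn_minkowski_plane (compact K) (compact L) (compact ((1 - l) • K + l • L))
    (((1 - l) • K + l • L).convex.add cB)
    ((by positivity : (0 : ℝ) < Real.pi / 4).trans_le (pi_div_four_le_volume K))
    ((by positivity : (0 : ℝ) < Real.pi / 4).trans_le (pi_div_four_le_volume L)) h1 hl.1 (by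
      rintro _ ⟨k, hk, b, hb, rfl⟩ _ ⟨m, hm, c, hc, rfl⟩
      rw [ConvexBody.coe_add, ConvexBody.coe_smul, ConvexBody.coe_smul]
      refine ⟨(1 - l) • k + l • m, Set.add_mem_add (Set.smul_mem_smul_set hk)
        (Set.smul_mem_smul_set hm), (1 - l) • b + l • c,
        cB hb hc h1.le hl.1.le (by ring), ?_⟩
      simp only [smul_add]
      abel)
  have hKv := pi_div_four_le_volume K
  have hLv := pi_div_four_le_volume L
  rw [wills_eq_volume, wills_eq_volume, wills_eq_volume]
  generalize volume.real ((K : Set (EuclideanSpace ℝ (Fin 2))) + (1 / 2 : ℝ) • unitBall 2) = A at *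
  generalize volume.real ((L : Set (EuclideanSpace ℝ (Fin 2))) + (1 / 2 : ℝ) • unitBall 2) = B at *
  have hδ : 0 < 3 * (1 - Real.pi / 4) := by linarith
  -- Chosen so that `d ^ 2 / 3` is the additive constant 1 - π/4. Then `d ≤ √A` and `d ≤ √B` follow
  -- from 3(1 - π/4) ≤ π/4, that is, π ≥ 3.
  obtain ⟨d, hd⟩ : ∃ d, d = √(3 * (1 - Real.pi / 4)) := ⟨_, rfl⟩
  have hd2 : d ^ 2 / 3 = 1 - Real.pi / 4 := by
    rw [hd, Real.sq_sqrt hδ.le]; ring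
  have key := rpow_third_combo_le (d := d) (x := √A) (y := √B) (hd ▸ Real.sqrt_pos.2 hδ)
    (hd ▸ Real.sqrt_le_sqrt (by linarith)) (hd ▸ Real.sqrt_le_sqrt (by linarith)) hl
  rw [Real.sq_sqrt (by linarith), Real.sq_sqrt (by linarith), hd2] at key
  refine key.trans (Real.rpow_le_rpow ?_ (add_le_add_left hBM _) (by norm_num))
  have : 0 ≤ 1 - Real.pi / 4 := by linarith
  positivity
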